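/- All rings are commutative with $1$. For a ring $R$ with total quotient ring $Q$ (the localization of $R$ at all its non-zerodivisors), an $R$-module $N$ is called *torsion-free* (resp. *divisible*) if multiplication by every non-zerodivisor of $R$ is injective (resp. surjective) on $N$, and *h-divisible* if there is a surjective $R$-linear map from a free $Q$-module onto $N$. A nonzero module is *hollow* if it is not the sum of two proper submodules. For $R$ Noetherian, $\operatorname{Coass}_R N$ is the set of primes $P$ of $R$ of the form $P=\{a\in R \mid aN'\neq N'\}$ for some hollow factor module $N'$ of $N$, and $\operatorname{Ass}_R N$ is the set of associated primes of $N$. An *injective cogenerator* is an injective $R$-module $E$ with $\operatorname{Hom}_R(N,E)\neq 0$ for every nonzero $R$-module $N$. **Theorem.** Let $R$ be a reduced Noetherian ring and let $M$ be an $R$-module. The following are equivalent: (a) $M$ is injective. (b) $\operatorname{Coass}_R \operatorname{Hom}_R(L,M) \subseteq \operatorname{Ass}_R L$ for every finitely generated $R$-module $L$. (c) $\operatorname{Hom}_R(L,M)$ is h-divisible for every torsion-free $R$-module $L$. (d) $\operatorname{Hom}_R(L,M)$ is divisible for every finitely generated torsion-free $R$-module $L$. (e) $\operatorname{Hom}_R(P,M)$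 is h-divisible for every $P \in \operatorname{Spec} R$. (f) $\operatorname{Hom}_R(P,M)$ is divisible for every $P \in \operatorname{Spec} R$. (g) $\operatorname{Ext}^1_R(R/P,M)$ is divisible for every $P \in \operatorname{Spec} R$. Moreover, if $(R,\mathfrak m,k) \to (S,\mathfrak n,\ell)$ is a local homomorphism of Noetherian local rings and $M$ is an Artinian $S$-module, regarded as an $R$-module by restriction of scalars, then each of the following conditions is also equivalent to $M$ being injective over $R$: (f$'$) $\operatorname{Hom}_R(\mathfrak m,M)$ is a divisible $R$-module. (g$'$) $\operatorname{Ext}^1_R(k,M)$ is a divisible $R$-module. In any case (with $R$ not necessarily local), the following are equivalent: (i) $M$ is an injective cogenerator. (ii) $\operatorname{Coass}_R \operatorname{Hom}_R(L,M) = \operatorname{Ass}_R L$ for every finitely generated $R$-module $L$. (iii) $M$ is injective and $\operatorname{Coass}_R \operatorname{Hom}_R(L,M) = \operatorname{Ass}_R L$ for every simple $R$-module $L$. -/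

import Mathlib

universe u

/-- Every non-zerodivisor of `R` acts surjectively on `M`. -/
def IsDivisibleModule (R M : Type u) [CommRing R] [AddCommGroup M] [Module R M] : Prop :=
  ∀ r ∈ nonZeroDivisors R, Function.Surjective (fun m : M => r • m)

/-- `M` is an `R`-linear quotient of a free module over the total quotient ring of `R`.
Here `FractionRing R` is the localization of `R` at all its non-zerodivisors (`R` need not be a
domain), and `ι →₀ FractionRing R` is the free module with basis indexed by `ι`. -/
def IsHDivisibleModule (R M : Type u) [CommRing R] [AddCommGroup M] [Module R M] : Prop :=
  ∃ (ι : Type u) (f : (ι →₀ FractionRing R) →ₗ[R] M), Function.Surjective f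

/-- A hollow module: nonzero, and not the sum of two proper submodules. -/
def IsHollowModule (R N : Type u) [CommRing R] [AddCommGroup N] [Module R N] : Prop :=
  Nontrivial N ∧ ∀ A B : Submodule R N, A ≠ ⊤ → B ≠ ⊤ → A ⊔ B ≠ ⊤

/-- The coassociated primes of `M`: the primes `P` of the form `{a | a N ≠ N}` for some
hollow (in particular nonzero) factor module `N = M ⧸ K` of `M`. -/
def coassociatedPrimes (R M : Type u) [CommRing R] [AddCommGroup M] [Module R M] :
    Set (Ideal R) :=
  {P | P.IsPrime ∧ ∃ K : Submodule R M, IsHollowModule R (M ⧸ K) ∧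
    (P : Set R) = {a : R | ¬ Function.Surjective (fun n : M ⧸ K => a • n)}}

/-- An injective module with a nonzero map to it from every nonzero module. -/
def IsInjectiveCogenerator (R M : Type u) [CommRing R] [AddCommGroup M] [Module R M] : Prop :=
  Module.Injective R M ∧
    ∀ (N : Type u) [AddCommGroup N] [Module R N], Nontrivial N → ∃ f : N →ₗ[R] M, f ≠ 0

/-- The `R`-module `Ext¹_R(L, M)`. -/
abbrev ExtOne (R L M : Type u) [CommRing R] [AddCommGroup L] [Module R L]
    [AddCommGroup M] [Module R M] : Type u :=
  CategoryTheory.Abelian.Ext.{u} (ModuleCat.of R L) (ModuleCat.of R M) 1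

/-! By Baer's criterion, injectivity of `M` means that maps from ideals to `M` extend to `R`. For a
proper ideal `I`, an associated prime of `R ⧸ I` has the form `P = (I : x)`; if maps extend from `P`
and from `I + (x)`, they extend from `I`. Noetherian induction thus reduces ideals containing `r` to
primes containing `r`. In a reduced ring `I ∩ ann I = 0` while `I + ann I` contains a
non-zerodivisor, so only primes `P` containing some non-zerodivisor `r` matter. For these, `g = r f`
gives `g x = f (r x) = x • f r`, so divisibility of `Hom(P, M)` suffices; and `Ext¹(R ⧸ P, M)` is
killed by `r`, so it vanishes if divisible.

The coassociated primes enter through two facts: a nonzero module over a Noetherian ring has a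
hollow quotient, and a hollow module `N` satisfies `P N ≠ N` for `P` its prime. If `M` is injective
and `P` is not associated to `L`, some `c ∉ P` kills the `P`-torsion of `L`, hence `c Hom(L, M) ⊆ P
Hom(L, M)`, which no hollow quotient with prime `P` allows. Conversely, a non-zerodivisor `r` not
surjective on `Hom(L, M)` lies in a coassociated prime, which cannot be associated to a torsion-free
`L`. -/

/-! ### Artinian modules over Noetherian rings -/

section Artinian

variable {R N : Type*} [CommRing R] [AddCommGroup N] [Module R N]

/-- A module in which every element is killed by a power of `a` is Artinian as soon as its
`a`-torsion submodule is. -/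
theorem isArtinian_of_isArtinian_torsionBy (a : R) (ht : ∀ y : N, ∃ n : ℕ, a ^ n • y = 0)
    (h : IsArtinian R (Submodule.torsionBy R N a)) : IsArtinian R N := by
  rw [← monotone_stabilizes_iff_artinian]
  intro f₀
  let f : ℕ → Submodule R N := fun i => OrderDual.ofDual (f₀ i)
  have hf : ∀ i j, i ≤ j → f j ≤ f i := fun i j hij => f₀.monotone hij
  -- `C i n` is the `a`-torsion part of `a ^ n • f i`. It decreases in both indices, and all the `C
  -- i n` together determine when the chain `f` stops.
  let C : ℕ → ℕ → Submodule R (Submodule.torsionBy R N a) := fun i n =>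
    (Submodule.map (LinearMap.lsmul R N (a ^ n)) (f i)).comap
      (Submodule.torsionBy R N a).subtype
  have hC : ∀ i n (y : Submodule.torsionBy R N a),
      y ∈ C i n ↔ ∃ z ∈ f i, a ^ n • z = (y : N) := by
    intro i n y; rfl
  have hCi : ∀ i j n, i ≤ j → C j n ≤ C i n := by
    intro i j n hij y hy
    obtain ⟨z, hz, e⟩ := (hC _ _ _).1 hy
    exact (hC _ _ _).2 ⟨z, hf i j hij hz, e⟩
  have hCn : ∀ i n k, n ≤ k → C i k ≤ C i n := by
    intro i n k hnk y hy
    obtain ⟨z, hz, e⟩ := (hC _ _ _).1 hy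
    refine (hC _ _ _).2 ⟨a ^ (k - n) • z, Submodule.smul_mem _ _ hz, ?_⟩
    rw [smul_smul, ← pow_add, Nat.add_sub_cancel' hnk, e]
  obtain ⟨_, ⟨⟨i₀, n₀⟩, rfl⟩, hmin⟩ := IsArtinian.set_has_minimal
    (Set.range fun p : ℕ × ℕ => C p.1 p.2) ⟨_, ⟨(0, 0), rfl⟩⟩
  have hstab : ∀ i n, i₀ ≤ i → n₀ ≤ n → C i n = C i₀ n₀ := by
    intro i n hi hn
    have hle : C i n ≤ C i₀ n₀ := (hCi _ _ _ hi).trans (hCn _ _ _ hn)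
    exact hle.eq_of_not_lt (hmin _ ⟨(i, n), rfl⟩)
  have hcol : ∀ n, ∃ s, ∀ i, s ≤ i → C s n = C i n := by
    intro n
    obtain ⟨s, hs⟩ := IsArtinian.monotone_stabilizes
      (⟨fun i => OrderDual.toDual (C i n), fun i j hij => hCi i j n hij⟩ :
        ℕ →o (Submodule R (Submodule.torsionBy R N a))ᵒᵈ)
    exact ⟨s, fun i hi => hs i hi⟩
  choose s hs using hcol
  -- Beyond `(i₀, n₀)` the array is constant; the finitely many columns `n < n₀` stabilize
  -- separately.
  let t := max i₀ ((Finset.range n₀).sup s)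
  have key : ∀ i n, t ≤ i → C t n ≤ C i n := by
    intro i n hi
    rcases lt_or_ge n n₀ with hn | hn
    · have h1 : s n ≤ t := le_max_of_le_right (Finset.le_sup (Finset.mem_range.2 hn))
      rw [← hs n t h1, ← hs n i (h1.trans hi)]
    · have h1 : i₀ ≤ t := le_max_left _ _
      rw [hstab t n h1 hn, hstab i n (h1.trans hi) hn]
  refine ⟨t, fun i hi => le_antisymm (f₀.monotone hi) ?_⟩
  change f t ≤ f i
  have hall : ∀ n : ℕ, ∀ y ∈ f t, a ^ n • y = 0 →
      y ∈ f i := by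
    intro n
    induction n with
    | zero => intro y _ h0; rw [pow_zero, one_smul] at h0; rw [h0]; exact Submodule.zero_mem _
    | succ n ih =>
      intro y hy h0
      have hmem : a ^ n • y ∈ Submodule.torsionBy R N a := by
        rw [Submodule.mem_torsionBy_iff, smul_smul, ← pow_succ', h0]
      obtain ⟨z, hz, e⟩ := (hC _ _ _).1 (key i n hi ((hC t n ⟨_, hmem⟩).2 ⟨y, hy, rfl⟩))
      have h1 := ih (y - z) (Submodule.sub_mem _ hy (hf t i hi hz)) (by
        rw [smul_sub, e, sub_self])
      simpa using Submodule.add_mem _ h1 hz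
  intro y hy
  obtain ⟨n, hn⟩ := ht y
  exact hall n y hy hn

/-- Iterates the preceding criterion, passing to the `a`-torsion for one `a ∈ s` at a time. -/
theorem isArtinian_of_forall_isArtinian_torsion (s : Finset R) {N : Type*} [AddCommGroup N]
    [Module R N] (ht : ∀ a ∈ s, ∀ y : N, ∃ n : ℕ, a ^ n • y = 0)
    (h : ∀ T : Submodule R N, (∀ a ∈ s, ∀ y ∈ T, a • y = 0) → IsArtinian R T) :
    IsArtinian R N := by
  classical
  induction s using Finset.induction_on generalizing N with
  | empty =>
    have := h ⊤ (by simp)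
    exact isArtinian_of_linearEquiv (Submodule.topEquiv : _ ≃ₗ[R] N)
  | insert a s _ ih =>
    refine isArtinian_of_isArtinian_torsionBy a (ht a (by simp)) (ih ?_ ?_)
    · intro b hb y
      obtain ⟨n, hn⟩ := ht b (by simp [hb]) y
      exact ⟨n, Subtype.ext hn⟩
    · intro T hT
      have := h (T.map (Submodule.subtype _)) (by
        rintro b hb _ ⟨y, hy, rfl⟩
        rcases Finset.mem_insert.1 hb with rfl | hb
        · exact y.2
        · exact congrArg Subtype.val (hT b hb y hy))
      exact isArtinian_of_linearEquiv
        (Submodule.equivMapOfInjective _ (Submodule.subtype_injective _) T).symm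

/-- A module over a Noetherian ring with a nonzero element that lies in every nonzero submodule
is Artinian. -/
theorem isArtinian_of_mem_of_ne_bot [IsNoetherianRing R] {x : N} (hx : x ≠ 0)
    (h : ∀ T : Submodule R N, T ≠ ⊥ → x ∈ T) : IsArtinian R N := by
  have hgen : ∀ y : N, y ≠ 0 → ∃ r : R, r • y = x := fun y hy =>
    Submodule.mem_span_singleton.1 (h (R ∙ y) (by simpa using hy))
  let m : Ideal R := LinearMap.ker (LinearMap.toSpanSingleton R N x)
  have hm : ∀ a, a ∈ m ↔ a • x = 0 := fun a => by simp [m]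
  obtain ⟨s, hs⟩ := (inferInstance : IsNoetherian R R).noetherian m
  have hsm : ∀ a ∈ s, a ∈ m := fun a ha => hs ▸ Submodule.subset_span ha
  refine isArtinian_of_forall_isArtinian_torsion s ?_ ?_
  · intro a ha y
    -- The annihilators of `a ^ n • y` stabilize. If `x = r • a ^ n • y` at that stage, then `a • x
    -- = 0` puts `r` in the next annihilator, hence in this one, and `x = 0`.
    by_contra! hne
    obtain ⟨n, hn⟩ := monotone_stabilizes_iff_noetherian.2 (inferInstance : IsNoetherian R R)
      ⟨fun n => LinearMap.ker (LinearMap.toSpanSingleton R N (a ^ n • y)), by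
        refine monotone_nat_of_le_succ fun n r hr => ?_
        simp only [LinearMap.mem_ker, LinearMap.toSpanSingleton_apply] at hr ⊢
        rw [pow_succ', mul_smul, smul_comm, hr, smul_zero]⟩
    obtain ⟨r, hr⟩ := hgen _ (hne n)
    have h1 : r ∈ LinearMap.ker (LinearMap.toSpanSingleton R N (a ^ (n + 1) • y)) := by
      simp only [LinearMap.mem_ker, LinearMap.toSpanSingleton_apply]
      rw [pow_succ', mul_smul, smul_comm, hr]
      exact (hm a).1 (hsm a ha)
    have h2 : r ∈ LinearMap.ker (LinearMap.toSpanSingleton R N (a ^ n • y)) := by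
      have := hn (n + 1) (Nat.le_succ n)
      simp only [OrderHom.coe_mk] at this
      rwa [this]
    simp only [LinearMap.mem_ker, LinearMap.toSpanSingleton_apply] at h2
    exact hx (hr.symm.trans h2)
  · intro T hT
    have hTm : ∀ a ∈ m, ∀ y ∈ T, a • y = 0 := by
      intro a ha y hy
      have : m ≤ LinearMap.ker (LinearMap.toSpanSingleton R N y) := by
        rw [← hs, Submodule.span_le]
        intro b hb
        simpa using hT b hb y hy
      simpa using this ha
    -- With `r • y = x` and `t • r • x = x`, the element `1 - t * r` kills `x`, hence `y`, so `y = t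
    -- • x`. Thus `T` is zero or simple.
    have hspan : ∀ y ∈ T, ∃ r : R, y = r • x := by
      intro y hy
      by_cases hy0 : y = 0
      · exact ⟨0, by simp [hy0]⟩
      obtain ⟨r, hr⟩ := hgen y hy0
      have hrx : r • x ≠ 0 := by
        intro h0
        have := hTm r ((hm r).2 h0) y hy
        exact hx (hr.symm.trans this)
      obtain ⟨t, ht⟩ := hgen _ hrx
      have h1 : (1 - t * r) ∈ m := by
        rw [hm, sub_smul, one_smul, mul_smul, ht, sub_self]
      have h2 := hTm _ h1 y hy
      rw [sub_smul, one_smul, sub_eq_zero, mul_smul, hr] at h2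
      exact ⟨t, h2⟩
    have hsimple : ∀ U : Submodule R T, U = ⊥ ∨ U = ⊤ := by
      intro U
      refine or_iff_not_imp_left.2 fun hU => ?_
      have hxU : x ∈ U.map T.subtype := h _ (by
        rw [Ne, (Submodule.map_injective_of_injective T.subtype_injective).eq_iff' (Submodule.map_bot _)]
        exact hU)
      obtain ⟨z, hz, e⟩ := hxU
      rw [eq_top_iff]
      rintro ⟨y, hy⟩ -
      obtain ⟨r, rfl⟩ := hspan y hy
      have : (⟨r • x, hy⟩ : T) = r • z := Subtype.ext (congrArg (r • ·) e.symm)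
      rw [this]
      exact U.smul_mem r hz
    rcases subsingleton_or_nontrivial T with hT' | hT'
    · infer_instance
    · have : IsSimpleModule R T := by
        rw [isSimpleModule_iff]
        exact { eq_bot_or_eq_top := hsimple }
      infer_instance

end Artinian

/-! ### Hollow modules and hollow quotients -/

section Hollow

variable {R : Type u} [CommRing R] {N N' : Type u} [AddCommGroup N] [Module R N]
  [AddCommGroup N'] [Module R N']

theorem IsHollowModule.of_surjective (h : IsHollowModule R N) [Nontrivial N'] (f : N →ₗ[R] N')
    (hf : Function.Surjective f) : IsHollowModule R N' := by
  refine ⟨inferInstance, fun A B hA hB hAB => ?_⟩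
  have hc : ∀ A : Submodule R N', A ≠ ⊤ → A.comap f ≠ ⊤ := by
    intro A hA hA'
    refine hA (eq_top_iff.2 fun y _ => ?_)
    obtain ⟨z, rfl⟩ := hf y
    exact (hA' ▸ Submodule.mem_top : z ∈ A.comap f)
  refine h.2 _ _ (hc A hA) (hc B hB) (eq_top_iff.2 fun z _ => ?_)
  have hz : f z ∈ A ⊔ B := hAB ▸ Submodule.mem_top
  obtain ⟨p, hp, q, hq, e⟩ := Submodule.mem_sup.1 hz
  obtain ⟨p', rfl⟩ := hf p
  refine Submodule.mem_sup.2 ⟨p', hp, z - p', ?_, by abel⟩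
  change f (z - p') ∈ B
  rw [map_sub, ← e, add_sub_cancel_left]
  exact hq

theorem IsArtinian.exists_isHollowModule_quotient [IsArtinian R N] [Nontrivial N] :
    ∃ K : Submodule R N, IsHollowModule R (N ⧸ K) := by
  -- For `A` minimal among submodules with a proper supplement `B`, the quotient by `B` is hollow: a
  -- decomposition `C + D` of it would make `A ⊓ C'` a smaller such submodule unless `A ≤ C'`.
  obtain ⟨A, ⟨B, hB, hAB⟩, hmin⟩ := IsArtinian.set_has_minimal
    {A : Submodule R N | ∃ B : Submodule R N, B ≠ ⊤ ∧ A ⊔ B = ⊤}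
    ⟨⊤, ⊥, bot_ne_top, by simp⟩
  refine ⟨B, Submodule.Quotient.nontrivial_iff.2 hB, fun C D hC hD hCD => ?_⟩
  have hsurj := B.mkQ_surjective
  have hBle : ∀ C : Submodule R (N ⧸ B), B ≤ C.comap B.mkQ := fun C => by
    intro z hz
    rw [Submodule.mem_comap, show B.mkQ z = 0 by simpa using hz]
    exact C.zero_mem
  have hmap : ∀ C : Submodule R (N ⧸ B), C.comap B.mkQ = ⊤ → C = ⊤ := by
    intro C h
    refine eq_top_iff.2 fun y _ => ?_
    obtain ⟨z, rfl⟩ := hsurj y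
    exact (h ▸ Submodule.mem_top : z ∈ C.comap B.mkQ)
  set C' := C.comap B.mkQ
  set D' := D.comap B.mkQ
  have hsup : (A ⊓ C') ⊔ D' = ⊤ := by
    refine eq_top_iff.2 fun z _ => ?_
    have hz : B.mkQ z ∈ C ⊔ D := hCD ▸ Submodule.mem_top
    obtain ⟨p, hp, q, hq, e⟩ := Submodule.mem_sup.1 hz
    obtain ⟨p', rfl⟩ := hsurj p
    obtain ⟨a, ha, b, hb, e'⟩ := Submodule.mem_sup.1 (hAB ▸ Submodule.mem_top : p' ∈ A ⊔ B)
    have hab : B.mkQ a = B.mkQ p' := by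
      rw [← e', map_add, show B.mkQ b = 0 by simpa using hb, add_zero]
    refine Submodule.mem_sup.2 ⟨a, ⟨ha, ?_⟩, z - a, ?_, by abel⟩
    · change B.mkQ a ∈ C
      rwa [hab]
    · change B.mkQ (z - a) ∈ D
      rw [map_sub, ← e, hab, add_sub_cancel_left]
      exact hq
  have hle : A ≤ C' := by
    by_contra hne
    exact hmin _ ⟨D', fun h => hD (hmap D h), hsup⟩ (inf_lt_left.2 hne)
  exact hC (hmap C (eq_top_iff.2 (hAB ▸ sup_le hle (hBle C))))

/-- Every nonzero module over a Noetherian ring has a hollow factor module. -/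
theorem exists_isHollowModule_quotient [IsNoetherianRing R] [Nontrivial N] :
    ∃ K : Submodule R N, IsHollowModule R (N ⧸ K) := by
  obtain ⟨x, hx⟩ := exists_ne (0 : N)
  -- With `K` maximal among submodules avoiding `x`, the image of `x` lies in every nonzero
  -- submodule of `N ⧸ K`.
  obtain ⟨K, -, hK, hmax⟩ := zorn_le_nonempty₀ {K : Submodule R N | x ∉ K} (by
    intro c hc hchain y hy
    refine ⟨sSup c, ?_, fun z hz => le_sSup hz⟩
    intro hmem
    obtain ⟨z, hz, hxz⟩ := (Submodule.mem_sSup_of_directed ⟨y, hy⟩ hchain.directedOn).1 hmem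
    exact hc hz hxz) ⊥ (by simpa using hx)
  have hx' : K.mkQ x ≠ 0 := by simpa using hK
  have : IsArtinian R (N ⧸ K) := isArtinian_of_mem_of_ne_bot hx' (by
    intro T hT
    by_contra hxT
    refine hT (eq_bot_iff.2 fun y hy => ?_)
    obtain ⟨z, rfl⟩ := K.mkQ_surjective y
    have : T.comap K.mkQ ≤ K := hmax (y := T.comap K.mkQ) hxT (by
      intro w hw
      rw [Submodule.mem_comap, show K.mkQ w = 0 by simpa using hw]
      exact T.zero_mem)
    have hz : z ∈ K := this hy
    simpa using hz)
  have : Nontrivial (N ⧸ K) := ⟨_, _, hx'⟩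
  obtain ⟨B, hB⟩ := IsArtinian.exists_isHollowModule_quotient (R := R) (N := N ⧸ K)
  have := hB.1
  let f : N →ₗ[R] (N ⧸ K) ⧸ B := B.mkQ ∘ₗ K.mkQ
  have hf : Function.Surjective f := B.mkQ_surjective.comp K.mkQ_surjective
  let e := f.quotKerEquivOfSurjective hf
  have : Nontrivial (N ⧸ LinearMap.ker f) := e.toEquiv.nontrivial
  exact ⟨LinearMap.ker f, hB.of_surjective e.symm.toLinearMap e.symm.surjective⟩

end Hollow

/-! ### Baer's criterion on few ideals -/

section Extension

variable {R : Type u} [CommRing R] {M : Type u} [AddCommGroup M] [Module R M]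

/-- Every linear map from the ideal `I` to `M` extends to `R`. -/
def ExtendsFromIdeal (M : Type u) [AddCommGroup M] [Module R M] (I : Ideal R) : Prop :=
  ∀ g : I →ₗ[R] M, ∃ m : M, ∀ x (hx : x ∈ I), g ⟨x, hx⟩ = x • m

theorem Module.Injective.of_extendsFromIdeal (h : ∀ I : Ideal R, ExtendsFromIdeal M I) :
    Module.Injective R M := by
  refine Module.Baer.injective fun I g => ?_
  obtain ⟨m, hm⟩ := h I g
  exact ⟨LinearMap.toSpanSingleton R M m, fun x hx => by simp [hm x hx]⟩

theorem ExtendsFromIdeal.top : ExtendsFromIdeal M (⊤ : Ideal R) := fun g =>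
  ⟨g ⟨1, Submodule.mem_top⟩, fun x hx => by rw [← map_smul]; congr 1; ext; simp⟩

/-- The element `m` is a value prescribed at `x`; `hg` is the compatibility needed to glue it with
`g` to a map on `I + (x)`. -/
theorem ExtendsFromIdeal.exists_of_sup_span {I : Ideal R} {x : R}
    (h : ExtendsFromIdeal M (I ⊔ Ideal.span {x})) (g : I →ₗ[R] M) (m : M)
    (hg : ∀ r (hr : r * x ∈ I), g ⟨r * x, hr⟩ = r • m) :
    ∃ m' : M, ∀ y (hy : y ∈ I), g ⟨y, hy⟩ = y • m' := by
  let f₁ : R →ₗ.[R] M := ⟨I, g⟩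
  let f₂ : R →ₗ.[R] M := LinearPMap.mkSpanSingleton' x m (by
    intro c hc
    have hc' : c * x = 0 := hc
    have h0 : c * x ∈ I := hc' ▸ I.zero_mem
    rw [RingHom.id_apply, ← hg c h0, show (⟨c * x, h0⟩ : I) = 0 from Subtype.ext hc', map_zero])
  have hcompat : ∀ (p : f₁.domain) (q : f₂.domain), (p : R) = q → f₁ p = f₂ q := by
    rintro ⟨p, hp⟩ ⟨q, hq⟩ (rfl : p = q)
    obtain ⟨r, rfl⟩ := Submodule.mem_span_singleton.1 hq
    exact (hg r hp).trans (LinearPMap.mkSpanSingleton'_apply x m _ r hq).symm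
  obtain ⟨m', hm'⟩ := h (f₁.sup f₂ hcompat).toFun
  refine ⟨m', fun y hy => ?_⟩
  have h1 := hm' y (Submodule.mem_sup_left hy)
  rw [← h1]
  exact ((LinearPMap.left_le_sup f₁ f₂ hcompat).2 (x := ⟨y, hy⟩) rfl)

/-- Extending `r ↦ g (r * x)` from the colon ideal `P` yields an admissible value at `x`. -/
theorem ExtendsFromIdeal.of_colon {I P : Ideal R} {x : R} (hP : ∀ r, r ∈ P ↔ r * x ∈ I)
    (hPe : ExtendsFromIdeal M P) (h : ExtendsFromIdeal M (I ⊔ Ideal.span {x})) :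
    ExtendsFromIdeal M I := by
  intro g
  let g' : P →ₗ[R] M := g ∘ₗ ((LinearMap.mulRight R x).restrict (p := P) (q := I)
    fun r hr => (hP r).1 hr)
  obtain ⟨m, hm⟩ := hPe g'
  exact h.exists_of_sup_span g m fun r hr => hm r ((hP r).2 hr)

theorem exists_isPrime_colon [IsNoetherianRing R] {I : Ideal R} (hI : I ≠ ⊤) :
    ∃ (P : Ideal R) (x : R), P.IsPrime ∧ I ≤ P ∧ x ∉ I ∧ ∀ r, r ∈ P ↔ r * x ∈ I := by
  have : Nontrivial (R ⧸ I) := Ideal.Quotient.nontrivial_iff.2 hI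
  obtain ⟨P, hP⟩ := associatedPrimes.nonempty R (R ⧸ I)
  obtain ⟨hPp, y, hy⟩ := isAssociatedPrime_iff.1 hP
  obtain ⟨x, rfl⟩ := Ideal.Quotient.mk_surjective y
  have hmem : ∀ r, r ∈ P ↔ r * x ∈ I := by
    intro r
    rw [hy, Submodule.mem_colon_singleton, Submodule.mem_bot, ← Ideal.Quotient.eq_zero_iff_mem,
      map_mul]
    rfl
  refine ⟨P, x, hPp, fun r hr => (hmem r).2 (I.mul_mem_right x hr), fun hx => ?_, hmem⟩
  exact hPp.ne_top ((Ideal.eq_top_iff_one P).2 ((hmem 1).2 (by simpa using hx)))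

theorem lt_sup_span_singleton {I : Ideal R} {x : R} (hx : x ∉ I) : I < I ⊔ Ideal.span {x} :=
  lt_of_le_of_ne le_sup_left fun h =>
    hx (h ▸ Submodule.mem_sup_right (Ideal.mem_span_singleton_self x))

theorem ExtendsFromIdeal.of_forall_isPrime [IsNoetherianRing R] (r : R)
    (h : ∀ P : Ideal R, P.IsPrime → r ∈ P → ExtendsFromIdeal M P) (I : Ideal R) (hr : r ∈ I) :
    ExtendsFromIdeal M I := by
  induction I using WellFoundedGT.induction with
  | ind I ih =>
    by_cases hI : I = ⊤
    · exact hI ▸ ExtendsFromIdeal.top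
    obtain ⟨P, x, hP, hle, hx, hmem⟩ := exists_isPrime_colon hI
    exact .of_colon hmem (h P hP (hle hr))
      (ih _ (lt_sup_span_singleton hx) (Submodule.mem_sup_left hr))

/-- In a reduced Noetherian ring, the sum of an ideal and its annihilator contains a
non-zerodivisor. -/
theorem exists_mem_sup_annihilator_nonZeroDivisors [IsNoetherianRing R] [IsReduced R]
    (I : Ideal R) : ∃ r ∈ I ⊔ Submodule.annihilator I, r ∈ nonZeroDivisors R := by
  by_contra! hne
  -- Prime avoidance puts the sum inside one associated prime `p = ann y`. Then `y` kills `I`, so `y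
  -- ∈ ann I ≤ p` and `y * y = 0`, against reducedness.
  have hsub : ((I ⊔ Submodule.annihilator I : Ideal R) : Set R) ⊆
      ⋃ p ∈ associatedPrimes R R, (id p : Ideal R) := by
    have := biUnion_associatedPrimes_eq_compl_nonZeroDivisors R
    simp only [id]
    rw [this]
    exact fun r hr => hne r hr
  obtain ⟨p, hp, hle⟩ := (Ideal.subset_union_prime_finite (associatedPrimes.finite R R) ⊤ ⊤
    fun p hp _ _ => hp.isPrime).1 hsub
  obtain ⟨hpp, y, hy⟩ := isAssociatedPrime_iff.1 hp
  have hmem : ∀ r ∈ p, r * y = 0 := fun r hr => by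
    rw [hy, Submodule.mem_colon_singleton] at hr
    simpa using hr
  have hyI : y ∈ Submodule.annihilator I := by
    rw [Submodule.mem_annihilator]
    intro r hr
    rw [smul_eq_mul, mul_comm]
    exact hmem r (hle (Submodule.mem_sup_left hr))
  have hyy : y * y = 0 := hmem y (hle (Submodule.mem_sup_right hyI))
  have hy0 : y = 0 := IsReduced.eq_zero y ⟨2, by rw [pow_two, hyy]⟩
  apply hpp.ne_top
  rw [hy, hy0]
  simp

theorem disjoint_annihilator [IsReduced R] (I : Ideal R) :
    Disjoint I (Submodule.annihilator I) := by
  rw [Submodule.disjoint_def]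
  intro x hx hx'
  exact IsReduced.eq_zero x ⟨2, (pow_two x).trans (Submodule.mem_annihilator.1 hx' x hx)⟩

/-- A map on `I` is first extended by zero on `J`. -/
theorem ExtendsFromIdeal.of_sup_of_disjoint {I J : Ideal R} (hd : Disjoint I J)
    (h : ExtendsFromIdeal M (I ⊔ J)) : ExtendsFromIdeal M I := by
  intro g
  let f₁ : R →ₗ.[R] M := ⟨I, g⟩
  let f₂ : R →ₗ.[R] M := ⟨J, 0⟩
  have hc := LinearPMap.sup_h_of_disjoint f₁ f₂ hd
  obtain ⟨m', hm'⟩ := h (f₁.sup f₂ hc).toFun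
  refine ⟨m', fun y hy => ?_⟩
  rw [← hm' y (Submodule.mem_sup_left hy)]
  exact ((LinearPMap.left_le_sup f₁ f₂ hc).2 (x := ⟨y, hy⟩) rfl)

/-- Over a reduced Noetherian ring, injectivity can be tested on the prime ideals that contain a
non-zerodivisor. -/
theorem Module.Injective.of_forall_isPrime [IsNoetherianRing R] [IsReduced R]
    (h : ∀ P : Ideal R, P.IsPrime → ∀ r ∈ P, r ∈ nonZeroDivisors R → ExtendsFromIdeal M P) :
    Module.Injective R M := by
  refine .of_extendsFromIdeal fun I => ?_
  obtain ⟨r, hr, hreg⟩ := exists_mem_sup_annihilator_nonZeroDivisors I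
  exact .of_sup_of_disjoint (disjoint_annihilator I)
    (.of_forall_isPrime r (fun P hP hrP => h P hP r hrP hreg) _ hr)

theorem IsDivisibleModule.extendsFromIdeal {I : Ideal R} (h : IsDivisibleModule R (I →ₗ[R] M))
    {r : R} (hr : r ∈ I) (hreg : r ∈ nonZeroDivisors R) : ExtendsFromIdeal M I := by
  intro g
  obtain ⟨f, rfl⟩ := h r hreg g
  refine ⟨f ⟨r, hr⟩, fun x hx => ?_⟩
  rw [← map_smul]
  change r • f ⟨x, hx⟩ = _
  rw [← map_smul]
  congr 1
  ext
  exact mul_comm _ _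

/-- Over a Noetherian local ring, injectivity of a module whose elements are killed by powers of
each element of the maximal ideal can be tested on the maximal ideal. -/
theorem Module.Injective.of_extendsFromIdeal_maximalIdeal [IsNoetherianRing R] [IsLocalRing R]
    (ht : ∀ a ∈ IsLocalRing.maximalIdeal R, ∀ y : M, ∃ n : ℕ, a ^ n • y = 0)
    (h : ExtendsFromIdeal M (IsLocalRing.maximalIdeal R)) : Module.Injective R M := by
  refine .of_extendsFromIdeal fun I => ?_
  induction I using WellFoundedGT.induction with
  | ind I ih =>
    by_cases hI : I = ⊤
    · exact hI ▸ ExtendsFromIdeal.top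
    obtain ⟨P, x, hP, hle, hx, hmem⟩ := exists_isPrime_colon hI
    have hsup := ih _ (lt_sup_span_singleton hx)
    rcases hle.lt_or_eq with hlt | rfl
    · exact .of_colon hmem (ih P hlt) hsup
    -- Now `I` is its own colon ideal by `x`, hence prime.
    by_cases hm : I = IsLocalRing.maximalIdeal R
    · rwa [hm]
    obtain ⟨a, ha, haI⟩ := SetLike.exists_of_lt
      (lt_of_le_of_ne (IsLocalRing.le_maximalIdeal hI) hm)
    -- If `a • g` extends by `m`, then `m` is an admissible value of `g` at `a`: for `r * a ∈ I`
    -- primality gives `r ∈ I`, so `g (r * a) = a • g r = r • m`. Since `I` is finitely generated, a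
    -- power of `a` kills `g`.
    have hpow : ∀ n : ℕ, ∀ g : I →ₗ[R] M, a ^ n • g = 0 →
        ∃ m : M, ∀ y (hy : y ∈ I), g ⟨y, hy⟩ = y • m := by
      intro n
      induction n with
      | zero =>
        intro g hg
        rw [pow_zero, one_smul] at hg
        exact ⟨0, fun y hy => by simp [hg]⟩
      | succ n ihn =>
        intro g hg
        obtain ⟨m, hm⟩ := ihn (a • g) (by rw [smul_smul, ← pow_succ, hg])
        refine (ih _ (lt_sup_span_singleton haI)).exists_of_sup_span g m fun r hr => ?_
        have hrI : r ∈ I := (hP.mem_or_mem hr).resolve_right haI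
        rw [← hm r hrI, LinearMap.smul_apply, ← map_smul]
        congr 1
        ext
        exact mul_comm _ _
    intro g
    obtain ⟨s, hs⟩ := (inferInstance : IsNoetherian R I).noetherian ⊤
    choose n hn using fun y : I => ht a ha (g y)
    refine hpow (s.sup n) g ?_
    refine LinearMap.ext_on_range (v := ((↑) : s → I)) (by simpa using hs) fun y => ?_
    have hle : n y ≤ s.sup n := Finset.le_sup y.2
    rw [LinearMap.smul_apply, ← Nat.sub_add_cancel hle, pow_add, mul_smul, hn, smul_zero]
    rfl

theorem IsArtinian.exists_pow_smul_eq_zero {S N : Type*} [CommRing S] [IsLocalRing S]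
    [AddCommGroup N] [Module S N] [IsArtinian S N] {b : S} (hb : b ∈ IsLocalRing.maximalIdeal S)
    (y : N) : ∃ n : ℕ, b ^ n • y = 0 := by
  obtain ⟨n, hn⟩ := IsArtinian.monotone_stabilizes
    (⟨fun n => OrderDual.toDual (S ∙ (b ^ n • y)), monotone_nat_of_le_succ fun n => by
      change S ∙ (b ^ (n + 1) • y) ≤ S ∙ (b ^ n • y)
      rw [Submodule.span_singleton_le_iff_mem, pow_succ', mul_smul]
      exact Submodule.smul_mem _ _ (Submodule.mem_span_singleton_self _)⟩ :
      ℕ →o (Submodule S N)ᵒᵈ)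
  have h1 : S ∙ (b ^ n • y) = S ∙ (b ^ (n + 1) • y) := hn (n + 1) (Nat.le_succ n)
  obtain ⟨s, hs⟩ := Submodule.mem_span_singleton.1
    (h1 ▸ Submodule.mem_span_singleton_self (b ^ n • y))
  refine ⟨n, ?_⟩
  -- From `b ^ n • y = s • b ^ (n + 1) • y`, the unit `1 - s * b` kills `b ^ n • y`.
  have hu : IsUnit (1 - s * b) := by
    have hsb : s * b ∈ IsLocalRing.maximalIdeal S := Ideal.mul_mem_left _ _ hb
    by_contra hu
    have := Ideal.add_mem _ ((IsLocalRing.mem_maximalIdeal _).2 hu) hsb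
    rw [sub_add_cancel] at this
    exact (IsLocalRing.mem_maximalIdeal _).1 this isUnit_one
  rw [← hu.smul_eq_zero, sub_smul, one_smul, mul_smul, smul_smul b, ← pow_succ', hs, sub_self]

end Extension

/-! ### Ext and extension of maps -/

section Ext

open CategoryTheory

variable {R : Type u} [CommRing R] {L M : Type u} [AddCommGroup L] [Module R L]
  [AddCommGroup M] [Module R M]

theorem ExtOne.smul_eq_zero {a : R} (ha : ∀ y : L, a • y = 0) (e : ExtOne R L M) : a • e = 0 := by
  have h0 : a • 𝟙 (ModuleCat.of R L) = 0 := by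
    ext y
    exact ha y
  rw [← Abelian.Ext.mk₀_id_comp e, ← Abelian.Ext.smul_comp, ← Abelian.Ext.mk₀_smul, h0,
    Abelian.Ext.mk₀_zero, Abelian.Ext.zero_comp]

theorem extendsFromIdeal_ker_of_subsingleton_extOne [Subsingleton (ExtOne R L M)]
    (f : R →ₗ[R] L) (hf : Function.Surjective f) : ExtendsFromIdeal M (LinearMap.ker f) := by
  intro g
  let S : ShortComplex (ModuleCat.{u} R) := ShortComplex.mk
    (ModuleCat.ofHom (LinearMap.ker f).subtype) (ModuleCat.ofHom f) (by
      ext y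
      exact y.2)
  have hS : S.ShortExact := by
    have hm : Mono S.f := (ModuleCat.mono_iff_injective _).2 Subtype.val_injective
    have he : Epi S.g := (ModuleCat.epi_iff_surjective _).2 hf
    refine ⟨(ShortComplex.ShortExact.moduleCat_exact_iff_function_exact S).2 ?_⟩
    exact LinearMap.exact_subtype_ker_map f
  -- The obstruction to extending `g` is its image under the connecting map into the vanishing
  -- `Ext¹`.
  obtain ⟨x, hx⟩ := Abelian.Ext.contravariant_sequence_exact₁ hS (ModuleCat.of R M)
    (Abelian.Ext.mk₀ (ModuleCat.ofHom g)) (add_zero 1)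
    (Subsingleton.elim (α := ExtOne R L M) _ _)
  obtain ⟨h, rfl⟩ := Abelian.Ext.homEquiv₀.symm.surjective x
  rw [Abelian.Ext.homEquiv₀_symm_apply, Abelian.Ext.mk₀_comp_mk₀] at hx
  have hx' := Abelian.Ext.homEquiv₀.symm.injective hx
  refine ⟨h.hom (1 : R), fun y hy => ?_⟩
  have h1 : (ModuleCat.ofHom g).hom ⟨y, hy⟩ = h.hom y := by
    rw [← hx']; rfl
  change (ModuleCat.ofHom g).hom ⟨y, hy⟩ = _
  rw [h1, ← map_smul]
  exact congrArg h.hom (mul_one y).symm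

theorem Module.Injective.subsingleton_extOne (h : Module.Injective R M) :
    Subsingleton (ExtOne R L M) := by
  have := (Module.injective_iff_injective_object R M).1 h
  exact Abelian.Ext.subsingleton_of_injective _ _ 0

/-- Since `r` kills the cyclic module `L`, it kills `Ext¹`; being also surjective there, it forces
`Ext¹ = 0`. -/
theorem IsDivisibleModule.extendsFromIdeal_ker (h : IsDivisibleModule R (ExtOne R L M))
    (f : R →ₗ[R] L) (hf : Function.Surjective f) {r : R} (hr : r ∈ LinearMap.ker f)
    (hreg : r ∈ nonZeroDivisors R) : ExtendsFromIdeal M (LinearMap.ker f) := by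
  have hz : ∀ e : ExtOne R L M, e = 0 := by
    intro e
    obtain ⟨e', rfl⟩ := h r hreg e
    refine ExtOne.smul_eq_zero (fun y => ?_) e'
    obtain ⟨z, rfl⟩ := hf y
    rw [← map_smul, smul_eq_mul, mul_comm, ← smul_eq_mul, map_smul, LinearMap.mem_ker.1 hr,
      smul_zero]
  have : Subsingleton (ExtOne R L M) := ⟨fun a b => (hz a).trans (hz b).symm⟩
  exact extendsFromIdeal_ker_of_subsingleton_extOne f hf

end Ext

/-! ### Divisibility and h-divisibility -/

section Divisible

variable {R : Type u} [CommRing R] {M : Type u} [AddCommGroup M] [Module R M]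

theorem IsHDivisibleModule.isDivisibleModule (h : IsHDivisibleModule R M) :
    IsDivisibleModule R M := by
  obtain ⟨ι, f, hf⟩ := h
  intro r hr m
  obtain ⟨q, rfl⟩ := hf m
  obtain ⟨u, hu⟩ := IsLocalization.map_units (FractionRing R) (⟨r, hr⟩ : nonZeroDivisors R)
  refine ⟨f (((u⁻¹ : (FractionRing R)ˣ) : FractionRing R) • q), ?_⟩
  change r • f _ = _
  rw [← map_smul]
  congr 1
  rw [← algebraMap_smul (FractionRing R) r, ← hu, smul_smul, Units.mul_inv, one_smul]

/-- A torsion-free `L` embeds in its localization `LQ`, so restriction maps the `Q`-module `Hom(LQ,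
M)` onto `Hom(L, M)`. The basis of the free module is `Hom(LQ, M)` itself. -/
theorem Module.Injective.isHDivisibleModule_hom (hM : Module.Injective R M) (L : Type u)
    [AddCommGroup L] [Module R L] [Module.IsTorsionFree R L] :
    IsHDivisibleModule R (L →ₗ[R] M) := by
  let LQ := LocalizedModule (nonZeroDivisors R) L
  let j : L →ₗ[R] LQ := LocalizedModule.mkLinearMap (nonZeroDivisors R) L
  have hj : Function.Injective j := by
    intro x y hxy
    obtain ⟨c, hc⟩ := (IsLocalizedModule.eq_iff_exists (nonZeroDivisors R) j).1 hxy
    exact Module.IsTorsionFree.isSMulRegular (isRegular_iff_mem_nonZeroDivisors.2 c.2) hc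
  let φ : (LQ →ₗ[R] M) → FractionRing R →ₗ[R] (L →ₗ[R] M) := fun h =>
    (LinearMap.lcomp R M j) ∘ₗ (LinearMap.compRight R h) ∘ₗ
      (Algebra.lsmul R R LQ : FractionRing R →ₐ[R] Module.End R LQ).toLinearMap
  refine ⟨LQ →ₗ[R] M, Finsupp.lsum R φ, fun g => ?_⟩
  obtain ⟨h, hh⟩ := hM.out j hj g
  refine ⟨Finsupp.single h 1, ?_⟩
  ext x
  rw [Finsupp.lsum_single]
  simpa [φ] using hh x

end Divisible

/-! ### Coassociated primes -/

section Coassociated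

variable {R : Type u} [CommRing R] {N N' : Type u} [AddCommGroup N] [Module R N]
  [AddCommGroup N'] [Module R N']

/-- Closure under addition is where hollowness is used: `(a + b) N ⊆ a N + b N`. -/
theorem IsHollowModule.exists_isPrime (h : IsHollowModule R N) :
    ∃ P : Ideal R, P.IsPrime ∧
      (P : Set R) = {a : R | ¬ Function.Surjective (fun n : N => a • n)} := by
  have := h.1
  have htop : ∀ a : R, Function.Surjective (fun n : N => a • n) ↔
      LinearMap.range (LinearMap.lsmul R N a) = ⊤ := fun a =>
    (LinearMap.range_eq_top (f := LinearMap.lsmul R N a)).symm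
  let P : Ideal R :=
    { carrier := {a : R | ¬ Function.Surjective (fun n : N => a • n)}
      zero_mem' := by
        intro h0
        obtain ⟨x, hx⟩ := exists_ne (0 : N)
        obtain ⟨y, hy⟩ := h0 x
        exact hx (by simpa using hy.symm)
      add_mem' := by
        intro a b ha hb hab
        rw [Set.mem_ofPred_eq, htop] at ha hb
        refine h.2 _ _ ha hb (eq_top_iff.2 fun y _ => ?_)
        obtain ⟨z, rfl⟩ := hab y
        exact Submodule.mem_sup.2 ⟨a • z, ⟨z, rfl⟩, b • z, ⟨z, rfl⟩, (add_smul a b z).symm⟩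
      smul_mem' := by
        intro c a ha hca
        refine ha fun y => ?_
        obtain ⟨z, rfl⟩ := hca y
        exact ⟨c • z, by simp only [smul_eq_mul, mul_smul]; exact smul_comm _ _ _⟩ }
  refine ⟨P, ⟨?_, ?_⟩, rfl⟩
  · rw [Ne, Ideal.eq_top_iff_one]
    exact fun h1 => h1 fun y => ⟨y, one_smul R y⟩
  · intro a b hab
    by_contra! hne
    have ha : Function.Surjective (fun n : N => a • n) := not_not.1 hne.1
    have hb : Function.Surjective (fun n : N => b • n) := not_not.1 hne.2
    refine hab fun y => ?_
    obtain ⟨z, rfl⟩ := ha y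
    obtain ⟨w, rfl⟩ := hb z
    exact ⟨w, mul_smul a b w⟩

/-- A nonzero factor module `N'` of `N` over a Noetherian ring gives a coassociated prime of `N`
that contains the annihilator of `N'` and no element acting surjectively on `N'`. -/
theorem exists_mem_coassociatedPrimes [IsNoetherianRing R] [Nontrivial N'] (f : N →ₗ[R] N')
    (hf : Function.Surjective f) : ∃ P ∈ coassociatedPrimes R N,
      (∀ a : R, (∀ y : N', a • y = 0) → a ∈ P) ∧
      ∀ a : R, Function.Surjective (fun y : N' => a • y) → a ∉ P := by
  obtain ⟨K, hK⟩ := exists_isHollowModule_quotient (R := R) (N := N')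
  have := hK.1
  let g : N →ₗ[R] N' ⧸ K := K.mkQ ∘ₗ f
  have hg : Function.Surjective g := K.mkQ_surjective.comp hf
  let e := g.quotKerEquivOfSurjective hg
  have hnt : Nontrivial (N ⧸ LinearMap.ker g) := e.toEquiv.nontrivial
  have hH : IsHollowModule R (N ⧸ LinearMap.ker g) :=
    hK.of_surjective e.symm.toLinearMap e.symm.surjective
  obtain ⟨P, hP, hPe⟩ := hH.exists_isPrime
  let q : N' →ₗ[R] N ⧸ LinearMap.ker g := e.symm.toLinearMap ∘ₗ K.mkQ
  have hq : Function.Surjective q := e.symm.surjective.comp K.mkQ_surjective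
  have hmem : ∀ a, a ∈ P ↔ ¬ Function.Surjective (fun n : N ⧸ LinearMap.ker g => a • n) :=
    fun a => Set.ext_iff.1 hPe a
  refine ⟨P, ⟨hP, _, hH, hPe⟩, fun a ha => (hmem a).2 fun hs => ?_, fun a ha haP => ?_⟩
  · obtain ⟨x, hx⟩ := exists_ne (0 : N ⧸ LinearMap.ker g)
    obtain ⟨y, rfl⟩ := hs x
    obtain ⟨z, rfl⟩ := hq y
    exact hx (by simp only [← map_smul, ha, map_zero])
  · refine (hmem a).1 haP fun y => ?_
    obtain ⟨z, rfl⟩ := hq y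
    obtain ⟨w, rfl⟩ := ha z
    exact ⟨q w, (map_smul q a w).symm⟩

/-- `P N` is a finite sum of the proper submodules `a N`, for `a` among the generators of `P`. -/
theorem IsHollowModule.smul_top_ne_top (h : IsHollowModule R N) {P : Ideal R} (hfg : P.FG)
    (hP : ∀ a ∈ P, ¬ Function.Surjective (fun n : N => a • n)) :
    P • (⊤ : Submodule R N) ≠ ⊤ := by
  classical
  have := h.1
  obtain ⟨s, rfl⟩ := hfg
  have hs : ∀ a ∈ s, ¬ Function.Surjective (fun n : N => a • n) := fun a ha =>
    hP a (Submodule.subset_span ha)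
  clear hP
  induction s using Finset.induction_on with
  | empty => simp
  | insert a s _ ih =>
    rw [Finset.coe_insert, Ideal.span_insert, Submodule.sup_smul]
    refine h.2 _ _ (fun htop => hs a (by simp) fun y => ?_) (ih fun b hb => hs b (by simp [hb]))
    have hy : y ∈ Ideal.span {a} • (⊤ : Submodule R N) := by
      rw [htop]; trivial
    rw [Submodule.ideal_span_singleton_smul] at hy
    obtain ⟨z, -, hz⟩ := hy
    exact ⟨z, hz⟩

end Coassociated

/-! ### Coassociated primes of Hom modules -/

section Hom

variable {R : Type u} [CommRing R] [IsNoetherianRing R] {M : Type u} [AddCommGroup M] [Module R M]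
  {L : Type u} [AddCommGroup L] [Module R L]

/-- A linear map from `L` to an injective module that vanishes on the elements killed by `P` is
in `P • Hom(L, M)`. -/
theorem Module.Injective.mem_smul_top_hom (hM : Module.Injective R M) (P : Ideal R)
    (φ : L →ₗ[R] M) (hφ : ∀ x : L, (∀ a ∈ P, a • x = 0) → φ x = 0) :
    φ ∈ P • (⊤ : Submodule R (L →ₗ[R] M)) := by
  classical
  obtain ⟨s, hs⟩ := (inferInstance : IsNoetherian R R).noetherian P
  have hsP : ∀ a ∈ s, a ∈ P := fun a ha => hs ▸ Submodule.subset_span ha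
  -- The kernel of `i` is the `P`-torsion of `L`, so `φ` factors through the image of `i` and
  -- extends to `s → L`; its components there are the coefficients of the generators.
  let i : L →ₗ[R] (s → L) := LinearMap.pi fun a => LinearMap.lsmul R L (a : R)
  have hker : LinearMap.ker i ≤ LinearMap.ker φ := by
    intro x hx
    refine hφ x fun a ha => ?_
    have : P ≤ LinearMap.ker (LinearMap.toSpanSingleton R L x) := by
      rw [← hs, Submodule.span_le]
      intro b hb
      have := congrFun (LinearMap.mem_ker.1 hx) ⟨b, hb⟩
      simpa [i] using this
    simpa using this ha
  obtain ⟨h, hh⟩ := hM.out ((LinearMap.ker i).liftQ i le_rfl)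
    (LinearMap.ker_eq_bot.1 (Submodule.ker_liftQ_eq_bot _ _ _ le_rfl))
    ((LinearMap.ker i).liftQ φ hker)
  have hsum : φ = ∑ a : s, (a : R) • (h ∘ₗ LinearMap.single R (fun _ : s => L) a) := by
    ext x
    have h1 : h (i x) = φ x := by simpa using hh ((LinearMap.ker i).mkQ x)
    rw [← h1, ← LinearMap.sum_single_apply (fun _ : s => L) (i x), map_sum,
      LinearMap.sum_apply]
    refine Finset.sum_congr rfl fun a _ => ?_
    rw [LinearMap.smul_apply, LinearMap.comp_apply, ← map_smul, ← map_smul]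
    rfl
  rw [hsum]
  exact Submodule.sum_mem _ fun a _ => Submodule.smul_mem_smul (hsP a a.2) trivial

theorem Module.Injective.coassociatedPrimes_hom_subset (hM : Module.Injective R M)
    [Module.Finite R L] : coassociatedPrimes R (L →ₗ[R] M) ⊆ associatedPrimes R L := by
  rintro P ⟨hP, K, hK, hPe⟩
  have hmem : ∀ a, a ∈ P ↔ ¬ Function.Surjective (fun n : (L →ₗ[R] M) ⧸ K => a • n) :=
    fun a => Set.ext_iff.1 hPe a
  by_contra hass
  let T : Submodule R L := Submodule.torsionBySet R L P
  have hT : ∀ x, x ∈ T ↔ ∀ a ∈ P, a • x = 0 := fun x => by simp [T, Submodule.mem_torsionBySet_iff]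
  -- Otherwise the annihilator of `x` would be exactly `P`.
  have hex : ∀ x : T, ∃ r : R, r ∉ P ∧ r • (x : L) = 0 := by
    intro x
    by_contra! hne
    refine hass (isAssociatedPrime_iff.2 ⟨hP, x, ?_⟩)
    ext r
    rw [Submodule.mem_colon_singleton, Submodule.mem_bot]
    exact ⟨fun hr => (hT x).1 x.2 r hr, fun hr => by_contra fun hrP => hne r hrP hr⟩
  choose c hcP hc using hex
  have : IsNoetherian R L := isNoetherian_of_isNoetherianRing_of_finite R L
  obtain ⟨s, hs⟩ := (inferInstance : IsNoetherian R T).noetherian ⊤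
  have hprod : ∏ x ∈ s, c x ∉ P := by
    rw [hP.prod_mem_iff]
    rintro ⟨x, -, hx⟩
    exact hcP x hx
  have hkill : ∀ x : L, (∀ a ∈ P, a • x = 0) → (∏ x ∈ s, c x) • x = 0 := by
    intro x hx
    have hle : (⊤ : Submodule R T) ≤
        LinearMap.ker (LinearMap.lsmul R L (∏ x ∈ s, c x) ∘ₗ T.subtype) := by
      rw [← hs, Submodule.span_le]
      intro y hy
      obtain ⟨d, hd⟩ := Finset.dvd_prod_of_mem c hy
      simp only [SetLike.mem_coe, LinearMap.mem_ker, LinearMap.comp_apply, Submodule.subtype_apply,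
        LinearMap.lsmul_apply]
      rw [hd, mul_comm, mul_smul, hc, smul_zero]
    exact hle (x := ⟨x, (hT x).2 hx⟩) trivial
  -- The product acts surjectively on the hollow quotient and carries `Hom(L, M)` into `P • Hom(L,
  -- M)`, so `P` times the quotient is everything.
  refine hK.smul_top_ne_top ((inferInstance : IsNoetherian R R).noetherian P)
    (fun a ha => (hmem a).1 ha) (eq_top_iff.2 fun y _ => ?_)
  obtain ⟨z, rfl⟩ := not_not.1 ((hmem _).not.1 hprod) y
  obtain ⟨φ, rfl⟩ := K.mkQ_surjective z
  have h1 := hM.mem_smul_top_hom P ((∏ x ∈ s, c x) • φ) (fun x hx => by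
    rw [LinearMap.smul_apply, ← map_smul, hkill x hx, map_zero])
  have h2 := Submodule.mem_map_of_mem (f := K.mkQ) h1
  rw [Submodule.map_smul''] at h2
  simp only [← map_smul]
  exact (smul_mono_right P le_top : _ ≤ P • (⊤ : Submodule R _)) h2

theorem isDivisibleModule_hom_of_coassociatedPrimes_subset [Module.IsTorsionFree R L]
    (h : coassociatedPrimes R (L →ₗ[R] M) ⊆ associatedPrimes R L) :
    IsDivisibleModule R (L →ₗ[R] M) := by
  intro r hr
  by_contra hs
  let T := LinearMap.range (LinearMap.lsmul R (L →ₗ[R] M) r)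
  have hT : T ≠ ⊤ := fun ht => hs (LinearMap.range_eq_top.1 ht)
  have : Nontrivial ((L →ₗ[R] M) ⧸ T) := Submodule.Quotient.nontrivial_iff.2 hT
  obtain ⟨P, hP, hmem, -⟩ := exists_mem_coassociatedPrimes T.mkQ T.mkQ_surjective
  obtain ⟨hPp, x, hx⟩ := isAssociatedPrime_iff.1 (h hP)
  have hrP : r ∈ P := hmem r (by
    intro y
    obtain ⟨z, rfl⟩ := T.mkQ_surjective y
    rw [← map_smul, Submodule.mkQ_apply, Submodule.Quotient.mk_eq_zero]
    exact ⟨z, rfl⟩)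
  have hx0 : x = 0 := by
    rw [hx, Submodule.mem_colon_singleton, Submodule.mem_bot] at hrP
    exact Module.IsTorsionFree.isSMulRegular (isRegular_iff_mem_nonZeroDivisors.2 hr)
      (hrP.trans (smul_zero r).symm)
  apply hPp.ne_top
  rw [hx, hx0]
  simp

/-- An embedding of `R ⧸ P` into `L` makes `Hom(R ⧸ P, M)` a nonzero quotient of `Hom(L, M)`. It is
killed by `P`, and elements outside `P` act surjectively on it, so `P` is the only prime it can
contribute. -/
theorem IsInjectiveCogenerator.associatedPrimes_subset (hM : IsInjectiveCogenerator R M) :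
    associatedPrimes R L ⊆ coassociatedPrimes R (L →ₗ[R] M) := by
  intro P hP
  obtain ⟨hPp, i, hi⟩ := (isAssociatedPrime_iff_exists_injective_linearMap P L).1 hP
  have : Nontrivial (R ⧸ P) := Ideal.Quotient.nontrivial_iff.2 hPp.ne_top
  obtain ⟨g, hg⟩ := hM.2 (R ⧸ P) inferInstance
  have : Nontrivial ((R ⧸ P) →ₗ[R] M) := ⟨_, _, hg⟩
  obtain ⟨Q, hQ, hmem, hnot⟩ := exists_mem_coassociatedPrimes (LinearMap.lcomp R M i) (by
    intro g
    obtain ⟨h, hh⟩ := hM.1.out i hi g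
    exact ⟨h, LinearMap.ext hh⟩)
  have hPQ : Q = P := by
    ext a
    refine ⟨fun ha => by_contra fun haP => hnot a ?_ ha, fun ha => hmem a fun f => ?_⟩
    · intro f
      have hinj : Function.Injective (LinearMap.lsmul R (R ⧸ P) a) := by
        rw [injective_iff_map_eq_zero]
        intro y hy
        obtain ⟨y, rfl⟩ := Ideal.Quotient.mk_surjective y
        have hy' : Ideal.Quotient.mk P (a * y) = 0 := by rw [map_mul]; exact hy
        rw [Ideal.Quotient.eq_zero_iff_mem] at hy' ⊢
        exact (hPp.mem_or_mem hy').resolve_left haP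
      obtain ⟨h, hh⟩ := hM.1.out _ hinj f
      refine ⟨h, LinearMap.ext fun y => ?_⟩
      rw [← hh y]
      exact (map_smul h a y).symm
    · ext
      have h0 : a • (1 : R ⧸ P) = 0 := by
        rw [← map_one (Ideal.Quotient.mk P)]
        exact Ideal.Quotient.eq_zero_iff_mem.2 (P.mul_mem_right 1 ha)
      change a • f 1 = 0
      rw [← map_smul, h0, map_zero]
  exact hPQ ▸ hQ

/-- Having a coassociated prime makes `Hom(R ⧸ m, M)` nonzero. Any nonzero cyclic submodule maps
onto some `R ⧸ m`, and the resulting map to `M` extends by injectivity. -/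
theorem Module.Injective.isInjectiveCogenerator (hM : Module.Injective R M)
    (h : ∀ (L : Type u) [AddCommGroup L] [Module R L], IsSimpleModule R L →
      coassociatedPrimes R (L →ₗ[R] M) = associatedPrimes R L) : IsInjectiveCogenerator R M := by
  refine ⟨hM, fun N _ _ hN => ?_⟩
  obtain ⟨x, hx⟩ := exists_ne (0 : N)
  let I : Ideal R := LinearMap.ker (LinearMap.toSpanSingleton R N x)
  have hI : I ≠ ⊤ := by
    rw [Ne, Ideal.eq_top_iff_one]
    simpa [I] using hx
  obtain ⟨m, hm, hle⟩ := Ideal.exists_le_maximal I hI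
  have hsimple : IsSimpleModule R (R ⧸ m) := isSimpleModule_iff_isCoatom.2 hm.out
  have hntm : Nontrivial (R ⧸ m) := Ideal.Quotient.nontrivial_iff.2 hm.ne_top
  obtain ⟨P, hP⟩ := associatedPrimes.nonempty R (R ⧸ m)
  rw [← h _ hsimple] at hP
  obtain ⟨-, K, hK, -⟩ := hP
  have := hK.1
  have : Nontrivial ((R ⧸ m) →ₗ[R] M) := K.mkQ_surjective.nontrivial
  obtain ⟨g, hg⟩ := exists_ne (0 : (R ⧸ m) →ₗ[R] M)
  obtain ⟨f, hf⟩ := hM.out (I.liftQ (LinearMap.toSpanSingleton R N x) le_rfl)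
    (LinearMap.ker_eq_bot.1 (Submodule.ker_liftQ_eq_bot _ _ _ le_rfl))
    (g ∘ₗ Submodule.mapQ I m LinearMap.id hle)
  refine ⟨f, ?_⟩
  rintro rfl
  apply hg
  ext
  have h1 := hf (I.mkQ 1)
  simpa using h1.symm

end Hom

/-! ### The equivalences -/

theorem theorem5p3 (R : Type u) [CommRing R] [IsNoetherianRing R] [IsReduced R]
    (M : Type u) [AddCommGroup M] [Module R M] :
    List.TFAE [
      Module.Injective R M,
      ∀ (L : Type u) [AddCommGroup L] [Module R L], Module.Finite R L →
        coassociatedPrimes R (L →ₗ[R] M) ⊆ associatedPrimes R L,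
      ∀ (L : Type u) [AddCommGroup L] [Module R L], Module.IsTorsionFree R L →
        IsHDivisibleModule R (L →ₗ[R] M),
      ∀ (L : Type u) [AddCommGroup L] [Module R L], Module.Finite R L →
        Module.IsTorsionFree R L → IsDivisibleModule R (L →ₗ[R] M),
      ∀ P : Ideal R, P.IsPrime → IsHDivisibleModule R (P →ₗ[R] M),
      ∀ P : Ideal R, P.IsPrime → IsDivisibleModule R (P →ₗ[R] M),
      ∀ P : Ideal R, P.IsPrime → IsDivisibleModule R (ExtOne R (R ⧸ P) M)] ∧
    (∀ [IsLocalRing R] (S : Type u) [CommRing S] [IsNoetherianRing S] [IsLocalRing S]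
      [Algebra R S] [IsLocalHom (algebraMap R S)] [Module S M] [IsScalarTower R S M]
      [IsArtinian S M],
      List.TFAE [
        Module.Injective R M,
        IsDivisibleModule R (IsLocalRing.maximalIdeal R →ₗ[R] M),
        IsDivisibleModule R (ExtOne R (IsLocalRing.ResidueField R) M)]) ∧
    List.TFAE [
      IsInjectiveCogenerator R M,
      ∀ (L : Type u) [AddCommGroup L] [Module R L], Module.Finite R L →
        coassociatedPrimes R (L →ₗ[R] M) = associatedPrimes R L,
      Module.Injective R M ∧
        ∀ (L : Type u) [AddCommGroup L] [Module R L], IsSimpleModule R L →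
          coassociatedPrimes R (L →ₗ[R] M) = associatedPrimes R L] := by
  have hbase : List.TFAE [
      Module.Injective R M,
      ∀ (L : Type u) [AddCommGroup L] [Module R L], Module.Finite R L →
        coassociatedPrimes R (L →ₗ[R] M) ⊆ associatedPrimes R L,
      ∀ (L : Type u) [AddCommGroup L] [Module R L], Module.IsTorsionFree R L →
        IsHDivisibleModule R (L →ₗ[R] M),
      ∀ (L : Type u) [AddCommGroup L] [Module R L], Module.Finite R L →
        Module.IsTorsionFree R L → IsDivisibleModule R (L →ₗ[R] M),
      ∀ P : Ideal R, P.IsPrime → IsHDivisibleModule R (P →ₗ[R] M),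
      ∀ P : Ideal R, P.IsPrime → IsDivisibleModule R (P →ₗ[R] M),
      ∀ P : Ideal R, P.IsPrime → IsDivisibleModule R (ExtOne R (R ⧸ P) M)] := by
    tfae_have 1 → 2 := fun h L _ _ _ => h.coassociatedPrimes_hom_subset
    tfae_have 2 → 4 := fun h L _ _ hf _ =>
      isDivisibleModule_hom_of_coassociatedPrimes_subset (h L hf)
    tfae_have 1 → 3 := fun h L _ _ _ => h.isHDivisibleModule_hom L
    tfae_have 3 → 5 := fun h P _ => h P inferInstance
    tfae_have 5 → 6 := fun h P hP => (h P hP).isDivisibleModule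
    tfae_have 4 → 6 := fun h P _ => h P inferInstance inferInstance
    tfae_have 6 → 1 := fun h =>
      .of_forall_isPrime fun P hP _ hr hreg => (h P hP).extendsFromIdeal hr hreg
    tfae_have 1 → 7 := fun h P _ r _ e => by
      have := h.subsingleton_extOne (L := R ⧸ P)
      exact ⟨0, Subsingleton.elim _ _⟩
    tfae_have 7 → 1 := fun h => .of_forall_isPrime fun P hP r hr hreg => by
      have := (h P hP).extendsFromIdeal_ker P.mkQ P.mkQ_surjective (r := r)
        (by rwa [Submodule.ker_mkQ]) hreg
      rwa [Submodule.ker_mkQ] at this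
    tfae_finish
  refine ⟨hbase, ?_, ?_⟩
  · intro _ S _ _ _ _ _ _ _ _
    have htors : ∀ a ∈ IsLocalRing.maximalIdeal R, ∀ y : M, ∃ n : ℕ, a ^ n • y = 0 := by
      intro a ha y
      obtain ⟨n, hn⟩ := IsArtinian.exists_pow_smul_eq_zero
        (b := algebraMap R S a) ((map_mem_nonunits_iff (algebraMap R S) a).2 ha) y
      exact ⟨n, by rwa [← map_pow, algebraMap_smul] at hn⟩
    have hcrit : (∀ r ∈ IsLocalRing.maximalIdeal R, r ∈ nonZeroDivisors R →
        ExtendsFromIdeal M (IsLocalRing.maximalIdeal R)) → Module.Injective R M := by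
      intro h
      by_cases hex : ∃ r ∈ IsLocalRing.maximalIdeal R, r ∈ nonZeroDivisors R
      · obtain ⟨r, hr, hreg⟩ := hex
        exact .of_extendsFromIdeal_maximalIdeal htors (h r hr hreg)
      -- With only zero-divisors in the maximal ideal, the criterion for reduced rings is vacuous
      -- and every module is injective.
      · exact .of_forall_isPrime fun P hP r hr hreg =>
          (hex ⟨r, IsLocalRing.le_maximalIdeal hP.ne_top hr, hreg⟩).elim
    tfae_have 1 → 2 := fun h => (h.isHDivisibleModule_hom _).isDivisibleModule
    tfae_have 2 → 1 := fun h => hcrit fun _ hr hreg => h.extendsFromIdeal hr hreg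
    tfae_have 1 → 3 := fun h r _ e => by
      have := h.subsingleton_extOne (L := IsLocalRing.ResidueField R)
      exact ⟨0, Subsingleton.elim _ _⟩
    tfae_have 3 → 1 := fun h => hcrit fun r hr hreg => by
      have hk : LinearMap.ker (Algebra.linearMap R (IsLocalRing.ResidueField R)) =
          IsLocalRing.maximalIdeal R := by
        ext a
        exact IsLocalRing.residue_eq_zero_iff a
      have := h.extendsFromIdeal_ker (Algebra.linearMap R (IsLocalRing.ResidueField R))
        IsLocalRing.residue_surjective (r := r) (by rwa [hk]) hreg
      rwa [hk] at this
    tfae_finish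
  · have hinj := (hbase.out 1 0 rfl rfl).1
    tfae_have 1 → 2 := fun h L _ _ hL =>
      (h.1.coassociatedPrimes_hom_subset).antisymm h.associatedPrimes_subset
    tfae_have 2 → 3 := fun h => ⟨hinj fun L _ _ hL => (h L hL).subset,
      fun L _ _ _ => h L inferInstance⟩
    tfae_have 3 → 1 := fun h => h.1.isInjectiveCogenerator h.2
    tfae_finish
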